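/- **Setting.** For $0<\tau<\frac{1}{3\sqrt3}$ let $y_-<0<y_{\min}<y_{\max}$ be the roots of $y^3-y^2+4\tau^2=0$, and let $y_\tau:\mathbb R\to\mathbb R$ be the unique solution of $\ddot y=-2y(3y-2)$, $y(0)=y_{\max}$, $\dot y(0)=0$; put $\rho_\tau=\sqrt{y_\tau}$. Let $$\mathrm p_\tau=\frac{K(k)}{r},\qquad r^2=y_{\max}-y_-,\qquad k^2=\frac{y_{\max}-y_{\min}}{y_{\max}-y_-},\qquad K(k)=\int_0^{\pi/2}\frac{d\theta}{\sqrt{1-k^2\sin^2\theta}}$$ ($2\mathrm p_\tau$ is the period of $y_\tau$). Define $\psi_1,\psi_2$ by $(1-y_\tau)\dot\psi_1=2\tau$, $y_\tau\dot\psi_2=-2\tau$, $\psi_1(0)=\psi_2(0)=0$, and put $w_1=-i\sqrt{1-\rho_\tau^2}\,e^{i\psi_1}$, $w_2=\rho_\tau e^{i\psi_2}$ and $\widehat{\mathrm p}_\tau=-\psi_2(2\mathrm p_\tau)$. With $e_1,e_2,e_3$ the standard basis of $\mathbb C^3$, let $$X_\tau:\mathbb S^1\times\mathbb R\to\mathbb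 S^5\subset\mathbb C^3,\qquad X_\tau(e^{is},t)=w_1(t)\,e_1+w_2(t)\,(\cos s\; e_2-\sin s\; e_3),$$ and let $\mathrm{Per}(X_\tau)$ be the set of $(s,t)\in\mathbb R^2$ with $X_\tau(e^{i(s'+s)},t'+t)=X_\tau(e^{is'},t')$ for all $s',t'\in\mathbb{R}$. For $x\in\mathbb R$ let $\widetilde{\mathsf T}_x=\operatorname{diag}(e^{ix},e^{-ix/2},e^{-ix/2})$, and let $\widetilde{\underline{\mathsf T}}_x$ and $\widetilde{\underline{\mathsf T}}$ be the orthogonal reflections of $\mathbb C^3$ with respect to the real subspaces $\widetilde{\mathsf T}_x\langle ie_1,e_2,e_3\rangle_{\mathbb R}$ and $\langle ie_1,e_2,e_3\rangle_{\mathbb R}$. **Lemma.** Let $\underline m\ge1$ be an integer, $m=4\underline m-1$, and let $\underline\tau\in(0,\frac1{3\sqrt3})$ satisfy $\widehat{\mathrm p}_{\underline\tau}=\frac\pi2\left(1+\frac1m\right)$. Then $$\mathrm{Per}(X_{\underline\tau})=\operatorname{span}_{\mathbb Z}\langle(2\pi,0),(0,2m\,\mathrm p_{\underline\tau})\rangle,$$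 $$\widetilde{\mathsf T}_{m\widehat{\mathrm p}_{\underline\tau}}=\widetilde{\mathsf T}_{-m\widehat{\mathrm p}_{\underline\tau}},\qquad \widetilde{\underline{\mathsf T}}_{m\widehat{\mathrm p}_{\underline\tau}}=\widetilde{\underline{\mathsf T}}_{-m\widehat{\mathrm p}_{\underline\tau}}=\widetilde{\underline{\mathsf T}},$$ and $X_{\underline\tau}$ factors through a smooth embedding into $\mathbb S^5$ of the torus $\mathbb S^1\times(\mathbb R/2m\,\mathrm p_{\underline\tau}\mathbb Z)$, that is, $X_{\underline\tau}(z,t)=F(z,[t])$ for such an embedding $F$. -/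

import Mathlib

open scoped Real ContDiff

noncomputable section

namespace U1Torus

/-- `ℂ³` with its Hermitian (hence also its real Euclidean) structure. -/
abbrev C3 : Type := EuclideanSpace ℂ (Fin 3)

/-! ### The conformal factor -/

/-- The real roots of the cubic `y³ - y² + 4τ² = 0`. -/
def cubicRoots (τ : ℝ) : Set ℝ := {y | y ^ 3 - y ^ 2 + 4 * τ ^ 2 = 0}

/-- The largest root `y_max`. -/
def yMax (τ : ℝ) : ℝ := sSup (cubicRoots τ)

/-- The smallest root `y_-`. -/
def yNeg (τ : ℝ) : ℝ := sInf (cubicRoots τ)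

/-- The root `y_min`: for `0 ≤ τ ≤ 1/(3√3)` the roots satisfy `y_- ≤ 0 ≤ y_min ≤ y_max`, so `y_min`
is the smallest non-negative one. -/
def yMin (τ : ℝ) : ℝ := sInf (cubicRoots τ ∩ Set.Ici 0)

/-- `y` is a solution on all of `ℝ` of the initial value problem
`y'' = -2 y (3 y - 2)`, `y 0 = y_max`, `y' 0 = 0`. -/
def IsConformalFactor (τ : ℝ) (y : ℝ → ℝ) : Prop :=
  Differentiable ℝ y ∧ (∀ t, HasDerivAt (deriv y) (-2 * y t * (3 * y t - 2)) t) ∧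
    y 0 = yMax τ ∧ deriv y 0 = 0

/-- `y_τ`: the (unique) solution of the initial value problem. -/
def y (τ : ℝ) : ℝ → ℝ := Classical.epsilon (IsConformalFactor τ)

/-- `ρ_τ`, with `y_τ = ρ_τ²`. -/
def rho (τ t : ℝ) : ℝ := √(y τ t)

/-- The complete elliptic integral of the first kind
`K(k) = ∫_0^{π/2} dθ / √(1 - k² sin² θ)`. -/
def ellipticK (k : ℝ) : ℝ := ∫ θ in (0 : ℝ)..(π / 2), 1 / √(1 - k ^ 2 * Real.sin θ ^ 2)

/-- `r = √(y_max - y_-)`. -/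
def r (τ : ℝ) : ℝ := √(yMax τ - yNeg τ)

/-- The modulus `k = √((y_max - y_min) / (y_max - y_-))`. -/
def modulus (τ : ℝ) : ℝ := √((yMax τ - yMin τ) / (yMax τ - yNeg τ))

/-- The half-period `p_τ = K(k) / r` of `y_τ`. -/
def p (τ : ℝ) : ℝ := ellipticK (modulus τ) / r τ

/-! ### The immersion `X_τ` -/

/-- `ψ₁`, the solution of `(1 - y_τ) ψ₁' = 2τ`, `ψ₁ 0 = 0`. -/
def psi1 (τ t : ℝ) : ℝ := ∫ u in (0 : ℝ)..t, 2 * τ / (1 - y τ u)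

/-- `ψ₂`, the solution of `y_τ ψ₂' = -2τ`, `ψ₂ 0 = 0`. -/
def psi2 (τ t : ℝ) : ℝ := ∫ u in (0 : ℝ)..t, -2 * τ / y τ u

/-- The angular period `p̂_τ = -ψ₂(2 p_τ)`. -/
def pHat (τ : ℝ) : ℝ := -psi2 τ (2 * p τ)

open Classical in
/-- The first profile function `w₁`. -/
def w1 (τ t : ℝ) : ℂ :=
  if τ = 0 then (Real.tanh t : ℂ)
  else -Complex.I * (√(1 - rho τ t ^ 2) : ℝ) * Complex.exp (Complex.I * (psi1 τ t : ℂ))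

open Classical in
/-- The second profile function `w₂`. -/
def w2 (τ t : ℝ) : ℂ :=
  if τ = 0 then ((1 / Real.cosh t : ℝ) : ℂ)
  else (rho τ t : ℂ) * Complex.exp (Complex.I * (psi2 τ t : ℂ))

/-- The map `X_τ : S¹ × ℝ → ℂ³`,
`X_τ (e^{is}, t) = w₁(t) e₁ + w₂(t) (cos s e₂ - sin s e₃)`. -/
def X (τ : ℝ) (q : Circle × ℝ) : C3 :=
  !₂[w1 τ q.2, w2 τ q.2 * ((q.1 : ℂ).re : ℂ), -(w2 τ q.2 * ((q.1 : ℂ).im : ℂ))]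

/-! ### Translations of the cylinder and the period lattice -/

/-- `T_x (e^{is}, t) = (e^{is}, t + x)`. -/
def T (x : ℝ) (q : Circle × ℝ) : Circle × ℝ := (q.1, q.2 + x)

/-- `S_x (e^{is}, t) = (e^{i(s+x)}, t)`. -/
def S (x : ℝ) (q : Circle × ℝ) : Circle × ℝ := (q.1 * Circle.exp x, q.2)

/-- The period lattice of a map defined on the cylinder `S¹ × ℝ`. -/
def Per (Y : Circle × ℝ → C3) : Set (ℝ × ℝ) := {v | Y ∘ S v.1 ∘ T v.2 = Y}

/-! ### Isometries of `ℂ³` -/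

/-- The matrix `T̃_x = diag(e^{ix}, e^{-ix/2}, e^{-ix/2})`. -/
def tildeT (x : ℝ) : Matrix (Fin 3) (Fin 3) ℂ :=
  Matrix.diagonal ![Complex.exp (Complex.I * x), Complex.exp (-(Complex.I * x) / 2),
    Complex.exp (-(Complex.I * x) / 2)]

/-- The real subspace `⟨J e₁, e₂, e₃⟩_ℝ` of `ℂ³`, where `J` is multiplication by `i`. -/
def reflBase : Submodule ℝ C3 :=
  Submodule.span ℝ {Complex.I • EuclideanSpace.single 0 1, EuclideanSpace.single 1 1,
    EuclideanSpace.single 2 1}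

/-- The real subspace `T̃_x ⟨J e₁, e₂, e₃⟩_ℝ` of `ℂ³`. -/
def reflSpace (x : ℝ) : Submodule ℝ C3 :=
  reflBase.map ((Matrix.toEuclideanLin (tildeT x)).restrictScalars ℝ)

/-- The orthogonal reflection of `ℂ³` with respect to `T̃_x ⟨J e₁, e₂, e₃⟩_ℝ`. -/
def reflT (x : ℝ) : C3 → C3 := (reflSpace x).reflection

/-- The orthogonal reflection of `ℂ³` with respect to `⟨J e₁, e₂, e₃⟩_ℝ`. -/
def reflT0 : C3 → C3 := reflBase.reflection

/-! ### Embedded tori -/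

/-- `F : S¹ × (ℝ / L ℤ) → S⁵ ⊂ ℂ³` is a smooth embedding: it takes values in the unit sphere, it
is a smooth immersion, and it is a homeomorphism onto its image. The smooth structure of the torus
is the one for which the covering `ℝ² → S¹ × (ℝ / L ℤ)`, `(s, t) ↦ (e^{is}, [t])`, is a local
diffeomorphism, so that smoothness and injectivity of the differential are those of the lift to
`ℝ²`; and `S⁵` is a submanifold of `ℂ³`. -/
structure IsEmbeddedTorus (L : ℝ) (F : Circle × AddCircle L → C3) : Prop where
  mem_sphere : ∀ q, F q ∈ Metric.sphere (0 : C3) 1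
  contDiff : ContDiff ℝ ∞ fun v : ℝ × ℝ => F (Circle.exp v.1, (v.2 : AddCircle L))
  injective_fderiv : ∀ v : ℝ × ℝ, Function.Injective
    (fderiv ℝ (fun v : ℝ × ℝ => F (Circle.exp v.1, (v.2 : AddCircle L))) v)
  isEmbedding : Topology.IsEmbedding F

end U1Torus

end

/-! Since `m + 1 = 4n`, the hypothesis on p̂ says `m p̂ = 2πn`, and `gcd(m, 2n) = 1`. The period
lattice and the embedding both follow from deciding when X(z,t) = X(z',t'), which is
`ClosingCondition.X_eq_X_iff`.

The squares of the last two coordinates of X sum to w₂², so a coincidence gives equal w₁ and equal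
w₂² at t and t'. The modulus of w₁ recovers y. The argument of w₁w₂² recovers y', because ψ₁ + 2ψ₂ =
-arctan(y'/4τ) (`psi1_add_two_mul_psi2`). The pair (y, y') determines t modulo 2p
(`exists_eq_add_of_y_eq`), so t' = t + 2jp. Over that shift w₁ turns by 2j p̂ and w₂ by -j p̂.
Equality of w₁ forces 2nj to be a multiple of m, hence m ∣ j. Then w₂ agrees as well, and z = z'.

The function y is given by a choice operator, so it is usable only after existence and uniqueness.
Existence comes from the explicit formula y_max - (y_max - y_min) sn²(rt), with the Jacobi amplitude
built as the inverse of the incomplete elliptic integral. Uniqueness comes from the first integral,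
which confines every solution to (0,1). The explicit formula also shows the period 2p.

The immersion property rests on w₂ and w₂' never vanishing. The isometry claims hold because at x =
2πn the diagonal entries are 1, (-1)ⁿ, (-1)ⁿ. -/

noncomputable section

namespace U1Torus

/-! ### The roots of the cubic -/

/-- `a < 0 < b < c` are the three roots of `y³ - y² + 4τ² = 0`, given by their elementary symmetric
functions. -/
structure OrderedRoots (τ a b c : ℝ) : Prop where
  neg : a < 0
  pos : 0 < b
  lt : b < c
  sum : a + b + c = 1
  sum_mul : a * b + b * c + c * a = 0
  prod : a * b * c = -4 * τ ^ 2

theorem exists_orderedRoots {τ : ℝ} (h0 : 0 < τ) (h1 : τ < 1 / (3 * √3)) :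
    ∃ a b c, OrderedRoots τ a b c := by
  have hsq : τ ^ 2 < 1 / 27 := by
    have h3 : (√3) ^ 2 = 3 := Real.sq_sqrt (by norm_num)
    calc τ ^ 2 < (1 / (3 * √3)) ^ 2 := by gcongr
      _ = 1 / 27 := by rw [div_pow, mul_pow, h3]; norm_num
  have hp : 0 < τ ^ 2 := by positivity
  have hc : Continuous fun y : ℝ => y ^ 3 - y ^ 2 + 4 * τ ^ 2 := by fun_prop
  obtain ⟨a, ⟨-, ha⟩, ha'⟩ := intermediate_value_Ioo (a := (-1 : ℝ)) (b := 0) (by norm_num)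
    hc.continuousOn (show (0 : ℝ) ∈ _ by constructor <;> norm_num <;> linarith)
  -- The point 2/3 is the local minimum of the cubic, with value 4(τ² - 1/27) < 0.
  obtain ⟨b, ⟨hb, hb2⟩, hb'⟩ := intermediate_value_Ioo' (a := (0 : ℝ)) (b := 2 / 3) (by norm_num)
    hc.continuousOn (show (0 : ℝ) ∈ _ by constructor <;> norm_num <;> linarith)
  obtain ⟨c, ⟨hc2, -⟩, hc'⟩ := intermediate_value_Ioo (a := (2 / 3 : ℝ)) (b := 1) (by norm_num)
    hc.continuousOn (show (0 : ℝ) ∈ _ by constructor <;> norm_num <;> linarith)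
  simp only at ha' hb' hc'
  -- Divided differences of the cubic, over two pairs of roots and then over all three, give Vieta's
  -- relations.
  have hab : a ^ 2 + a * b + b ^ 2 - a - b = 0 :=
    mul_left_cancel₀ (sub_ne_zero.2 (show b ≠ a by linarith)) (by linear_combination hb' - ha')
  have hbc : c ^ 2 + c * b + b ^ 2 - c - b = 0 :=
    mul_left_cancel₀ (sub_ne_zero.2 (show c ≠ b by linarith)) (by linear_combination hc' - hb')
  have hsum : a + b + c - 1 = 0 :=
    mul_left_cancel₀ (sub_ne_zero.2 (show c ≠ a by linarith)) (by linear_combination hbc - hab)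
  have hmul : a * b + b * c + c * a = 0 := by linear_combination (a + b) * hsum - hab
  exact ⟨a, b, c, ha, hb, by linarith, by linarith, hmul, by
    linear_combination a * hmul - a ^ 2 * hsum + ha'⟩

namespace OrderedRoots

variable {τ a b c : ℝ}

theorem eq_mul (h : OrderedRoots τ a b c) (y : ℝ) :
    y ^ 3 - y ^ 2 + 4 * τ ^ 2 = (y - a) * (y - b) * (y - c) := by
  linear_combination y ^ 2 * h.sum - y * h.sum_mul + h.prod

theorem cubicRoots_eq (h : OrderedRoots τ a b c) : cubicRoots τ = {a, b, c} := by
  ext y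
  simp [cubicRoots, h.eq_mul, sub_eq_zero, or_assoc]

theorem yMax_eq (h : OrderedRoots τ a b c) : yMax τ = c := by
  refine IsGreatest.csSup_eq ⟨by simp [h.cubicRoots_eq], fun y hy => ?_⟩
  rw [h.cubicRoots_eq] at hy
  rcases hy with rfl | rfl | rfl <;> linarith [h.neg, h.pos, h.lt]

theorem yNeg_eq (h : OrderedRoots τ a b c) : yNeg τ = a := by
  refine IsLeast.csInf_eq ⟨by simp [h.cubicRoots_eq], fun y hy => ?_⟩
  rw [h.cubicRoots_eq] at hy
  rcases hy with rfl | rfl | rfl <;> linarith [h.neg, h.pos, h.lt]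

theorem yMin_eq (h : OrderedRoots τ a b c) : yMin τ = b := by
  refine IsLeast.csInf_eq ⟨⟨by simp [h.cubicRoots_eq], h.pos.le⟩, fun y hy => ?_⟩
  rw [h.cubicRoots_eq] at hy
  obtain ⟨rfl | rfl | rfl, hy0⟩ := hy
  · exact absurd hy0 (by simpa using h.neg)
  · exact le_rfl
  · exact h.lt.le

theorem modulus_sq (h : OrderedRoots τ a b c) : modulus τ ^ 2 = (c - b) / (c - a) := by
  rw [modulus, h.yMax_eq, h.yMin_eq, h.yNeg_eq, Real.sq_sqrt]
  exact div_nonneg (by linarith [h.lt]) (by linarith [h.neg, h.pos, h.lt])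

theorem modulus_sq_lt_one (h : OrderedRoots τ a b c) : modulus τ ^ 2 < 1 := by
  rw [h.modulus_sq, div_lt_one] <;> linarith [h.neg, h.pos, h.lt]

theorem r_sq (h : OrderedRoots τ a b c) : r τ ^ 2 = c - a := by
  rw [r, h.yMax_eq, h.yNeg_eq, Real.sq_sqrt]
  linarith [h.neg, h.pos, h.lt]

theorem r_pos (h : OrderedRoots τ a b c) : 0 < r τ := by
  rw [r, h.yMax_eq, h.yNeg_eq]
  exact Real.sqrt_pos.2 (by linarith [h.neg, h.pos, h.lt])

end OrderedRoots

/-! ### The Jacobi amplitude -/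

/-- The incomplete elliptic integral of the first kind. -/
def ellipticF (k φ : ℝ) : ℝ := ∫ θ in (0 : ℝ)..φ, 1 / √(1 - k ^ 2 * Real.sin θ ^ 2)

section Amplitude

variable {k : ℝ}

theorem one_sub_mul_sin_sq_pos (hk : k ^ 2 < 1) (θ : ℝ) : 0 < 1 - k ^ 2 * Real.sin θ ^ 2 := by
  nlinarith [Real.sin_sq_le_one θ, sq_nonneg (Real.sin θ), sq_nonneg k]

theorem continuous_ellipticF_integrand (hk : k ^ 2 < 1) :
    Continuous fun θ => 1 / √(1 - k ^ 2 * Real.sin θ ^ 2) :=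
  continuous_const.div (by fun_prop) fun θ =>
    (Real.sqrt_pos.2 (one_sub_mul_sin_sq_pos hk θ)).ne'

theorem hasDerivAt_ellipticF (hk : k ^ 2 < 1) (φ : ℝ) :
    HasDerivAt (ellipticF k) (1 / √(1 - k ^ 2 * Real.sin φ ^ 2)) φ :=
  (continuous_ellipticF_integrand hk).integral_hasStrictDerivAt 0 φ |>.hasDerivAt

theorem one_le_ellipticF_integrand (hk : k ^ 2 < 1) (θ : ℝ) :
    1 ≤ 1 / √(1 - k ^ 2 * Real.sin θ ^ 2) := by
  rw [one_le_div (Real.sqrt_pos.2 (one_sub_mul_sin_sq_pos hk θ)), Real.sqrt_le_one]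
  nlinarith [mul_nonneg (sq_nonneg k) (sq_nonneg (Real.sin θ))]

theorem strictMono_ellipticF (hk : k ^ 2 < 1) : StrictMono (ellipticF k) :=
  strictMono_of_hasDerivAt_pos (hasDerivAt_ellipticF hk) fun φ =>
    one_pos.trans_le (one_le_ellipticF_integrand hk φ)

theorem ellipticF_zero : ellipticF k 0 = 0 := by simp [ellipticF]

/-- The integrand has period π and is symmetric about π/2, so each full period contributes 2K. -/
theorem ellipticF_add_int_mul_pi (hk : k ^ 2 < 1) (φ : ℝ) (j : ℤ) :
    ellipticF k (φ + j * π) = ellipticF k φ + j * (2 * ellipticK k) := by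
  set g : ℝ → ℝ := fun θ => 1 / √(1 - k ^ 2 * Real.sin θ ^ 2) with hg
  have hc : Continuous g := continuous_ellipticF_integrand hk
  have hi : ∀ a b, IntervalIntegrable g MeasureTheory.volume a b := fun a b =>
    hc.intervalIntegrable a b
  have hper : Function.Periodic g π := fun θ => by simp [hg, Real.sin_add_pi]
  have hhalf : ∫ θ in (π / 2)..π, g θ = ellipticK k := by
    have := intervalIntegral.integral_comp_sub_left g π (a := 0) (b := π / 2)
    rw [ellipticK, sub_zero, sub_half] at *
    rw [← this]
    simp [hg, Real.sin_pi_sub]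
  have hK : ∫ θ in (0 : ℝ)..π, g θ = 2 * ellipticK k := by
    rw [← intervalIntegral.integral_add_adjacent_intervals (hi 0 (π / 2)) (hi _ _), hhalf, two_mul]
    rfl
  have h1 := hper.intervalIntegral_add_zsmul_eq j φ hi
  rw [hper.intervalIntegral_add_eq φ 0, zero_add, hK] at h1
  simp only [zsmul_eq_mul] at h1
  rw [ellipticF, ellipticF,
    ← intervalIntegral.integral_add_adjacent_intervals (hi 0 φ) (hi _ _), h1]

theorem ellipticK_pos (hk : k ^ 2 < 1) : 0 < ellipticK k := by
  have := strictMono_ellipticF hk (show (0 : ℝ) < π / 2 by positivity)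
  rwa [ellipticF_zero] at this

/-- The values 2jK at jπ are unbounded in both directions, and continuity fills the gaps. -/
theorem surjective_ellipticF (hk : k ^ 2 < 1) : Function.Surjective (ellipticF k) := by
  have hK := ellipticK_pos hk
  have hc : Continuous (ellipticF k) :=
    continuous_iff_continuousAt.2 fun φ => (hasDerivAt_ellipticF hk φ).continuousAt
  intro u
  have hval : ∀ j : ℤ, ellipticF k (j * π) = j * (2 * ellipticK k) := fun j => by
    simpa [ellipticF_zero] using ellipticF_add_int_mul_pi hk 0 j
  obtain ⟨j, hj⟩ := exists_int_lt (u / (2 * ellipticK k))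
  obtain ⟨l, hl⟩ := exists_int_gt (u / (2 * ellipticK k))
  rw [lt_div_iff₀ (by positivity), ← hval] at hj
  rw [div_lt_iff₀ (by positivity), ← hval] at hl
  exact mem_range_of_exists_le_of_exists_ge hc ⟨_, hj.le⟩ ⟨_, hl.le⟩

/-- The Jacobi amplitude, the inverse of `ellipticF`. -/
def amplitude (k : ℝ) : ℝ → ℝ := Function.invFun (ellipticF k)

theorem ellipticF_amplitude (hk : k ^ 2 < 1) (u : ℝ) : ellipticF k (amplitude k u) = u :=
  Function.invFun_eq (surjective_ellipticF hk u)

theorem amplitude_ellipticF (hk : k ^ 2 < 1) (φ : ℝ) : amplitude k (ellipticF k φ) = φ :=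
  Function.leftInverse_invFun (strictMono_ellipticF hk).injective φ

theorem amplitude_zero (hk : k ^ 2 < 1) : amplitude k 0 = 0 := by
  simpa [ellipticF_zero] using amplitude_ellipticF hk 0

theorem amplitude_add (hk : k ^ 2 < 1) (u : ℝ) :
    amplitude k (u + 2 * ellipticK k) = amplitude k u + π := by
  apply (strictMono_ellipticF hk).injective
  have := ellipticF_add_int_mul_pi hk (amplitude k u) 1
  simp only [Int.cast_one, one_mul] at this
  rw [this, ellipticF_amplitude hk, ellipticF_amplitude hk]

theorem continuous_amplitude (hk : k ^ 2 < 1) : Continuous (amplitude k) := by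
  have hmono : StrictMono (amplitude k) := fun u v huv => by
    rwa [← (strictMono_ellipticF hk).lt_iff_lt, ellipticF_amplitude hk, ellipticF_amplitude hk]
  exact hmono.monotone.continuous_of_surjective fun φ => ⟨_, amplitude_ellipticF hk φ⟩

theorem hasDerivAt_amplitude (hk : k ^ 2 < 1) (u : ℝ) :
    HasDerivAt (amplitude k) (√(1 - k ^ 2 * Real.sin (amplitude k u) ^ 2)) u := by
  have h := HasDerivAt.of_local_left_inverse (continuous_amplitude hk).continuousAt
    (hasDerivAt_ellipticF hk (amplitude k u))
    (one_pos.trans_le (one_le_ellipticF_integrand hk _)).ne'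
    (Filter.Eventually.of_forall (ellipticF_amplitude hk))
  simpa using h

end Amplitude

/-! ### The conformal factor in terms of the amplitude -/

/-- `y_max - (y_max - y_min) sn²(r t)`. -/
def snFactor (τ t : ℝ) : ℝ :=
  yMax τ - (yMax τ - yMin τ) * Real.sin (amplitude (modulus τ) (r τ * t)) ^ 2

/-- The derivative of `snFactor`. -/
def snFactorDeriv (τ t : ℝ) : ℝ :=
  -((yMax τ - yMin τ) * r τ) * √(1 - modulus τ ^ 2 *
    Real.sin (amplitude (modulus τ) (r τ * t)) ^ 2) *
    Real.sin (2 * amplitude (modulus τ) (r τ * t))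

section

variable {τ a b c : ℝ}

theorem OrderedRoots.hasDerivAt_amplitude_mul (h : OrderedRoots τ a b c) (t : ℝ) :
    HasDerivAt (fun t => amplitude (modulus τ) (r τ * t))
      (√(1 - modulus τ ^ 2 * Real.sin (amplitude (modulus τ) (r τ * t)) ^ 2) * r τ) t :=
  (hasDerivAt_amplitude h.modulus_sq_lt_one (r τ * t)).comp t
    (by simpa using (hasDerivAt_id t).const_mul (r τ))

theorem OrderedRoots.hasDerivAt_snFactor (h : OrderedRoots τ a b c) (t : ℝ) :
    HasDerivAt (snFactor τ) (snFactorDeriv τ t) t := by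
  have := (((h.hasDerivAt_amplitude_mul t).sin.pow 2).const_mul (yMax τ - yMin τ)).const_sub
    (yMax τ)
  refine this.congr_deriv ?_
  rw [snFactorDeriv, Real.sin_two_mul]
  ring

theorem OrderedRoots.hasDerivAt_snFactorDeriv (h : OrderedRoots τ a b c) (t : ℝ) :
    HasDerivAt (snFactorDeriv τ) (-2 * snFactor τ t * (3 * snFactor τ t - 2)) t := by
  have hφ := h.hasDerivAt_amplitude_mul t
  have hpos := one_sub_mul_sin_sq_pos h.modulus_sq_lt_one (amplitude (modulus τ) (r τ * t))
  have hd := (((hφ.sin.pow 2).const_mul (modulus τ ^ 2)).const_sub 1).sqrt hpos.ne'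
  have := (hd.const_mul (-((yMax τ - yMin τ) * r τ))).mul (hφ.const_mul 2).sin
  refine this.congr_deriv ?_
  simp only [snFactor, Pi.pow_apply]
  have hk : modulus τ ^ 2 * r τ ^ 2 = c - b := by
    rw [h.modulus_sq, h.r_sq, div_mul_cancel₀]
    linarith [h.neg, h.pos, h.lt]
  have hr := h.r_sq
  have hsum := h.sum
  have hmul := h.sum_mul
  rw [h.yMax_eq, h.yMin_eq, Real.sin_two_mul, Real.cos_two_mul]
  set φ := amplitude (modulus τ) (r τ * t)
  have hsc := Real.sin_sq_add_cos_sq φ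
  have hD := Real.sq_sqrt hpos.le
  have hD0 := (Real.sqrt_pos.2 hpos).ne'
  set D := √(1 - modulus τ ^ 2 * Real.sin φ ^ 2)
  set s := Real.sin φ
  set e := Real.cos φ
  have he : e ^ 2 = 1 - s ^ 2 := by linear_combination hsc
  have hr' : r τ ^ 2 = 2 * c + b - 1 := by linear_combination hr - hsum
  have hcb : 3 * c ^ 2 - 2 * c = (c - b) * (2 * c + b - 1) := by
    linear_combination (c + b) * hsum - hmul
  -- With the square root cancelled, the equation is polynomial in sin φ. The roots enter only
  -- through r² = 2c + b - 1, k²r² = c - b and `hcb`.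
  have key : -((c - b) * r τ ^ 2) * (D ^ 2 * 2 * (2 * e ^ 2 - 1)
      - 2 * modulus τ ^ 2 * s ^ 2 * e ^ 2) =
      -2 * (c - (c - b) * s ^ 2) * (3 * (c - (c - b) * s ^ 2) - 2) := by
    rw [hD, he]
    linear_combination (-2 * (c - b) * (1 - 2 * s ^ 2)) * hr' + 2 * hcb +
      (c - b) * (2 * s ^ 2 * (1 - 2 * s ^ 2) + 2 * s ^ 2 * (1 - s ^ 2)) * hk
  rw [← key]
  field_simp
  push_cast
  ring

theorem OrderedRoots.isConformalFactor_snFactor (h : OrderedRoots τ a b c) :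
    IsConformalFactor τ (snFactor τ) := by
  have hd : deriv (snFactor τ) = snFactorDeriv τ := funext fun t => (h.hasDerivAt_snFactor t).deriv
  refine ⟨fun t => (h.hasDerivAt_snFactor t).differentiableAt, ?_, ?_, ?_⟩
  · rw [hd]
    exact h.hasDerivAt_snFactorDeriv
  · simp [snFactor, amplitude_zero h.modulus_sq_lt_one]
  · simp [hd, snFactorDeriv, amplitude_zero h.modulus_sq_lt_one]

/-! ### First integral and uniqueness -/

/-- The energy y'² + 4y³ - 4y² is conserved; at 0 it equals -16τ² because y_max is a root of the
cubic. -/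
theorem IsConformalFactor.deriv_sq {y : ℝ → ℝ} (hy : IsConformalFactor τ y)
    (h : OrderedRoots τ a b c) (t : ℝ) :
    deriv y t ^ 2 = 4 * (y t ^ 2 * (1 - y t) - 4 * τ ^ 2) := by
  obtain ⟨hdiff, hdd, h0, hd0⟩ := hy
  have hE : ∀ t, HasDerivAt (fun t => deriv y t ^ 2 + 4 * y t ^ 3 - 4 * y t ^ 2) 0 t := fun t => by
    refine ((((hdd t).pow 2).add (((hdiff t).hasDerivAt.pow 3).const_mul 4)).sub
      (((hdiff t).hasDerivAt.pow 2).const_mul 4)).congr_deriv ?_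
    push_cast
    ring
  have := is_const_of_deriv_eq_zero (fun t => (hE t).differentiableAt) (fun t => (hE t).deriv) t 0
  simp only [h0, hd0] at this
  have hc := h.eq_mul (yMax τ)
  rw [h.yMax_eq, sub_self, mul_zero] at hc
  rw [h.yMax_eq] at this
  linear_combination this + 4 * hc

theorem IsConformalFactor.sq_mul_pos {y : ℝ → ℝ} (hy : IsConformalFactor τ y)
    (h : OrderedRoots τ a b c) (hτ : 0 < τ) (t : ℝ) : 0 < y t ^ 2 * (1 - y t) := by
  nlinarith [hy.deriv_sq h t, sq_nonneg (deriv y t), pow_pos hτ 2]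

theorem IsConformalFactor.lt_one {y : ℝ → ℝ} (hy : IsConformalFactor τ y)
    (h : OrderedRoots τ a b c) (hτ : 0 < τ) (t : ℝ) : y t < 1 := by
  linarith [pos_of_mul_pos_right (hy.sq_mul_pos h hτ t) (sq_nonneg _)]

/-- By the first integral y cannot vanish, so it keeps the sign of y(0) = y_max. -/
theorem IsConformalFactor.pos {y : ℝ → ℝ} (hy : IsConformalFactor τ y)
    (h : OrderedRoots τ a b c) (hτ : 0 < τ) (t : ℝ) : 0 < y t := by
  by_contra! ht
  have h0 : 0 ≤ y 0 := by
    rw [hy.2.2.1, h.yMax_eq]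
    linarith [h.pos, h.lt]
  obtain ⟨s, hs⟩ := mem_range_of_exists_le_of_exists_ge hy.1.continuous ⟨t, ht⟩ ⟨0, h0⟩
  simpa [hs] using hy.sq_mul_pos h hτ s

/-- The quadratic vector field is not globally Lipschitz, but the difference of two solutions
satisfies a linear equation with coefficient 4 - 6(y + z), which is bounded by 8 since both lie in
(0,1). It is compared with the zero solution. -/
theorem IsConformalFactor.unique {y z : ℝ → ℝ} (hy : IsConformalFactor τ y)
    (hz : IsConformalFactor τ z) (h : OrderedRoots τ a b c) (hτ : 0 < τ) : y = z := by
  let q : ℝ → ℝ := fun t => 4 - 6 * (y t + z t)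
  have hq : ∀ t, |q t| ≤ 8 := fun t => by
    rw [abs_le]
    constructor <;> simp only [q] <;>
      linarith [hy.pos h hτ t, hy.lt_one h hτ t, hz.pos h hτ t, hz.lt_one h hτ t]
  let v : ℝ → ℝ × ℝ → ℝ × ℝ := fun t u => (u.2, q t * u.1)
  have hv : ∀ t, LipschitzWith 8 (v t) := fun t => by
    refine LipschitzWith.of_dist_le_mul fun u w => ?_
    simp only [v, dist_eq_norm, Prod.norm_def, Prod.fst_sub, Prod.snd_sub, ← mul_sub, norm_mul]
    have h1 := le_max_left ‖u.1 - w.1‖ ‖u.2 - w.2‖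
    have h2 := le_max_right ‖u.1 - w.1‖ ‖u.2 - w.2‖
    have h3 := norm_nonneg (u.1 - w.1)
    refine max_le ?_ ?_
    · push_cast; linarith
    · push_cast
      exact mul_le_mul (hq t) h1 h3 (by norm_num)
  have hf : ∀ t, HasDerivAt (fun t => (y t - z t, deriv y t - deriv z t))
      (v t (y t - z t, deriv y t - deriv z t)) t := fun t => by
    refine ((hy.1 t).hasDerivAt.sub (hz.1 t).hasDerivAt).prodMk
      (((hy.2.1 t).sub (hz.2.1 t)).congr_deriv ?_)
    simp only [q]
    ring
  have := ODE_solution_unique_univ (v := v) (s := fun _ => Set.univ) (K := 8) (t₀ := 0)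
    (f := fun t => (y t - z t, deriv y t - deriv z t)) (g := fun _ => 0)
    (fun t => (hv t).lipschitzOnWith) (fun t => ⟨hf t, trivial⟩)
    (fun t => ⟨(hasDerivAt_const t (0 : ℝ × ℝ)).congr_deriv (by ext <;> simp [v]), trivial⟩)
    (by simp [hy.2.2.1, hy.2.2.2, hz.2.2.1, hz.2.2.2])
  funext t
  exact sub_eq_zero.1 (congrArg Prod.fst (congrFun this t))

end

/-! ### Properties of `y_τ` -/

/-- The admissible parameters `0 < τ < 1 / (3√3)`. -/
structure Admissible (τ : ℝ) : Prop where
  pos : 0 < τ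
  lt : τ < 1 / (3 * √3)

namespace Admissible

variable {τ : ℝ}

theorem isConformalFactor_y (h : Admissible τ) : IsConformalFactor τ (y τ) := by
  obtain ⟨a, b, c, hr⟩ := exists_orderedRoots h.pos h.lt
  exact Classical.epsilon_spec ⟨_, hr.isConformalFactor_snFactor⟩

theorem y_eq_snFactor (h : Admissible τ) : y τ = snFactor τ := by
  obtain ⟨a, b, c, hr⟩ := exists_orderedRoots h.pos h.lt
  exact h.isConformalFactor_y.unique hr.isConformalFactor_snFactor hr h.pos

theorem deriv_y_eq (h : Admissible τ) : deriv (y τ) = snFactorDeriv τ := by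
  obtain ⟨a, b, c, hr⟩ := exists_orderedRoots h.pos h.lt
  rw [h.y_eq_snFactor]
  exact funext fun t => (hr.hasDerivAt_snFactor t).deriv

theorem y_pos (h : Admissible τ) (t : ℝ) : 0 < y τ t := by
  obtain ⟨a, b, c, hr⟩ := exists_orderedRoots h.pos h.lt
  exact h.isConformalFactor_y.pos hr h.pos t

theorem y_lt_one (h : Admissible τ) (t : ℝ) : y τ t < 1 := by
  obtain ⟨a, b, c, hr⟩ := exists_orderedRoots h.pos h.lt
  exact h.isConformalFactor_y.lt_one hr h.pos t

theorem deriv_y_sq (h : Admissible τ) (t : ℝ) :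
    deriv (y τ) t ^ 2 = 4 * (y τ t ^ 2 * (1 - y τ t) - 4 * τ ^ 2) := by
  obtain ⟨a, b, c, hr⟩ := exists_orderedRoots h.pos h.lt
  exact h.isConformalFactor_y.deriv_sq hr t

/-- Bootstrapping: y'' is a polynomial in y, so each pass through the equation gains regularity. -/
theorem contDiff_y (h : Admissible τ) : ContDiff ℝ ∞ (y τ) := by
  obtain ⟨hd, hdd, -, -⟩ := h.isConformalFactor_y
  rw [contDiff_infty]
  intro n
  induction n with
  | zero => exact contDiff_zero.2 hd.continuous
  | succ n ih =>
    push_cast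
    refine contDiff_succ_iff_deriv.2 ⟨hd, by simp, ?_⟩
    refine ContDiff.of_le (n := (n : WithTop ℕ∞) + 1) ?_ (by simp)
    refine contDiff_succ_iff_deriv.2 ⟨fun t => (hdd t).differentiableAt, by simp, ?_⟩
    rw [show deriv (deriv (y τ)) = fun t => -2 * y τ t * (3 * y τ t - 2) from
      funext fun t => (hdd t).deriv]
    fun_prop

theorem p_pos (h : Admissible τ) : 0 < p τ := by
  obtain ⟨a, b, c, hr⟩ := exists_orderedRoots h.pos h.lt
  exact div_pos (ellipticK_pos hr.modulus_sq_lt_one) hr.r_pos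

theorem periodic_y (h : Admissible τ) : Function.Periodic (y τ) (2 * p τ) := by
  obtain ⟨a, b, c, hr⟩ := exists_orderedRoots h.pos h.lt
  intro t
  have : r τ * (t + 2 * p τ) = r τ * t + 2 * ellipticK (modulus τ) := by
    have := hr.r_pos.ne'
    rw [p]
    field_simp
  simp [h.y_eq_snFactor, snFactor, this, amplitude_add hr.modulus_sq_lt_one, Real.sin_add_pi]

/-- With φ the amplitude at rt, y determines sin² φ, hence cos 2φ and the square root in y'; then y'
determines sin 2φ. So φ is known modulo π, and rt modulo 2K. -/
theorem exists_eq_add_of_y_eq (h : Admissible τ) {t t' : ℝ} (h1 : y τ t = y τ t')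
    (h2 : deriv (y τ) t = deriv (y τ) t') : ∃ j : ℤ, t' = t + j * (2 * p τ) := by
  obtain ⟨a, b, c, hr⟩ := exists_orderedRoots h.pos h.lt
  have hk := hr.modulus_sq_lt_one
  have hcb : yMax τ - yMin τ ≠ 0 := by
    rw [hr.yMax_eq, hr.yMin_eq]
    linarith [hr.lt]
  have hr0 := hr.r_pos.ne'
  rw [h.y_eq_snFactor] at h1
  rw [h.deriv_y_eq] at h2
  simp only [snFactor, snFactorDeriv] at h1 h2
  have hs := mul_left_cancel₀ hcb (sub_right_injective h1)
  rw [hs] at h2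
  have hsin := mul_left_cancel₀ (mul_ne_zero (neg_ne_zero.2 (mul_ne_zero hcb hr0))
    (Real.sqrt_pos.2 (one_sub_mul_sin_sq_pos hk _)).ne') h2
  have hcos : Real.cos (2 * amplitude (modulus τ) (r τ * t)) =
      Real.cos (2 * amplitude (modulus τ) (r τ * t')) := by
    rw [Real.cos_two_mul, Real.cos_two_mul, Real.cos_sq', Real.cos_sq', hs]
  have hang := Real.Angle.cos_sin_inj hcos hsin
  obtain ⟨j, hj⟩ := Real.Angle.angle_eq_iff_two_pi_dvd_sub.1 hang.symm
  refine ⟨j, ?_⟩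
  have hφ : amplitude (modulus τ) (r τ * t') = amplitude (modulus τ) (r τ * t) + j * π := by
    linarith
  have := congrArg (ellipticF (modulus τ)) hφ
  rw [ellipticF_add_int_mul_pi hk, ellipticF_amplitude hk, ellipticF_amplitude hk] at this
  rw [p]
  field_simp
  linarith

/-! ### The angular functions -/

theorem rho_sq (h : Admissible τ) (t : ℝ) : rho τ t ^ 2 = y τ t := Real.sq_sqrt (h.y_pos t).le

theorem rho_pos (h : Admissible τ) (t : ℝ) : 0 < rho τ t := Real.sqrt_pos.2 (h.y_pos t)

theorem contDiff_integrand₁ (h : Admissible τ) : ContDiff ℝ ∞ fun u => 2 * τ / (1 - y τ u) :=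
  contDiff_const.div (contDiff_const.sub h.contDiff_y) fun u => (sub_pos.2 (h.y_lt_one u)).ne'

theorem contDiff_integrand₂ (h : Admissible τ) : ContDiff ℝ ∞ fun u => -2 * τ / y τ u :=
  contDiff_const.div h.contDiff_y fun u => (h.y_pos u).ne'

theorem hasDerivAt_psi1 (h : Admissible τ) (t : ℝ) :
    HasDerivAt (psi1 τ) (2 * τ / (1 - y τ t)) t :=
  (h.contDiff_integrand₁.continuous.integral_hasStrictDerivAt 0 t).hasDerivAt

theorem hasDerivAt_psi2 (h : Admissible τ) (t : ℝ) : HasDerivAt (psi2 τ) (-2 * τ / y τ t) t :=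
  (h.contDiff_integrand₂.continuous.integral_hasStrictDerivAt 0 t).hasDerivAt

theorem contDiff_psi1 (h : Admissible τ) : ContDiff ℝ ∞ (psi1 τ) :=
  contDiff_infty_iff_deriv.2 ⟨fun t => (h.hasDerivAt_psi1 t).differentiableAt, by
    rw [funext fun t => (h.hasDerivAt_psi1 t).deriv]
    exact h.contDiff_integrand₁⟩

theorem contDiff_psi2 (h : Admissible τ) : ContDiff ℝ ∞ (psi2 τ) :=
  contDiff_infty_iff_deriv.2 ⟨fun t => (h.hasDerivAt_psi2 t).differentiableAt, by
    rw [funext fun t => (h.hasDerivAt_psi2 t).deriv]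
    exact h.contDiff_integrand₂⟩

/-- Both sides vanish at 0, and their derivatives agree by the equation for y'' and the first
integral. This links the two angles and gives the phase of w₁w₂² in terms of y'. -/
theorem psi1_add_two_mul_psi2 (h : Admissible τ) (t : ℝ) :
    psi1 τ t + 2 * psi2 τ t = -Real.arctan (deriv (y τ) t / (4 * τ)) := by
  obtain ⟨-, hdd, -, hd0⟩ := h.isConformalFactor_y
  have hD : ∀ t, HasDerivAt
      (fun t => psi1 τ t + 2 * psi2 τ t + Real.arctan (deriv (y τ) t / (4 * τ))) 0 t := fun t => by
    refine (((h.hasDerivAt_psi1 t).add ((h.hasDerivAt_psi2 t).const_mul 2)).add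
      ((hdd t).div_const (4 * τ)).arctan).congr_deriv ?_
    have hτ := h.pos.ne'
    have h1 := (h.y_pos t).ne'
    have h2 := (sub_pos.2 (h.y_lt_one t)).ne'
    have : 1 + (deriv (y τ) t / (4 * τ)) ^ 2 = y τ t ^ 2 * (1 - y τ t) / (4 * τ ^ 2) := by
      rw [div_pow, h.deriv_y_sq]
      field_simp
      ring
    rw [this]
    field_simp
    ring
  have := is_const_of_deriv_eq_zero (fun t => (hD t).differentiableAt) (fun t => (hD t).deriv) t 0
  have h1 : psi1 τ 0 = 0 := intervalIntegral.integral_same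
  have h2 : psi2 τ 0 = 0 := intervalIntegral.integral_same
  simp only [h1, h2, hd0, zero_div, Real.arctan_zero] at this
  linarith

theorem psi2_add (h : Admissible τ) (t : ℝ) (j : ℤ) :
    psi2 τ (t + j * (2 * p τ)) = psi2 τ t - j * pHat τ := by
  have hi : ∀ a b, IntervalIntegrable (fun u => -2 * τ / y τ u) MeasureTheory.volume a b :=
    fun a b => h.contDiff_integrand₂.continuous.intervalIntegrable a b
  have hper : Function.Periodic (fun u => -2 * τ / y τ u) (2 * p τ) := fun u => by
    simp only [h.periodic_y u]
  have h1 := hper.intervalIntegral_add_zsmul_eq j t hi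
  rw [hper.intervalIntegral_add_eq t 0, zero_add] at h1
  simp only [zsmul_eq_mul] at h1
  rw [pHat, psi2, psi2, psi2,
    ← intervalIntegral.integral_add_adjacent_intervals (hi 0 t) (hi _ _), h1]
  ring

theorem periodic_deriv_y (h : Admissible τ) : Function.Periodic (deriv (y τ)) (2 * p τ) :=
  fun t => by
    rw [← deriv_comp_add_const, funext h.periodic_y]

/-- As y' is periodic, ψ₁ + 2ψ₂ is too, so the increment of ψ₁ is -2 times that of ψ₂. -/
theorem psi1_add (h : Admissible τ) (t : ℝ) (j : ℤ) :
    psi1 τ (t + j * (2 * p τ)) = psi1 τ t + 2 * j * pHat τ := by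
  have h1 := h.psi1_add_two_mul_psi2 t
  have h2 := h.psi1_add_two_mul_psi2 (t + j * (2 * p τ))
  rw [h.periodic_deriv_y.int_mul j t, h.psi2_add] at h2
  linarith

end Admissible

theorem X_exp_apply_one (τ s t : ℝ) : X τ (Circle.exp s, t) 1 = w2 τ t * (Real.cos s : ℂ) := by
  rw [← Complex.exp_ofReal_mul_I_re]
  rfl

theorem X_exp_apply_two (τ s t : ℝ) : X τ (Circle.exp s, t) 2 = -(w2 τ t * (Real.sin s : ℂ)) := by
  rw [← Complex.exp_ofReal_mul_I_im]
  rfl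

namespace Admissible

variable {τ : ℝ}

/-! ### The profile functions -/

theorem w1_eq (h : Admissible τ) (t : ℝ) :
    w1 τ t = -Complex.I * (√(1 - y τ t) : ℝ) * Complex.exp (Complex.I * (psi1 τ t : ℂ)) := by
  rw [w1, if_neg h.pos.ne', h.rho_sq]

theorem w2_eq (h : Admissible τ) (t : ℝ) :
    w2 τ t = (rho τ t : ℂ) * Complex.exp (Complex.I * (psi2 τ t : ℂ)) := by
  rw [w2, if_neg h.pos.ne']

theorem contDiff_w1 (h : Admissible τ) : ContDiff ℝ ∞ (w1 τ) := by
  have h1 : ContDiff ℝ ∞ fun t => ((√(1 - y τ t) : ℝ) : ℂ) :=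
    Complex.ofRealCLM.contDiff.comp
      ((contDiff_const.sub h.contDiff_y).sqrt fun t => (sub_pos.2 (h.y_lt_one t)).ne')
  have h2 : ContDiff ℝ ∞ fun t => (psi1 τ t : ℂ) := Complex.ofRealCLM.contDiff.comp h.contDiff_psi1
  rw [funext h.w1_eq]
  exact (contDiff_const.mul h1).mul (contDiff_const.mul h2).cexp

theorem contDiff_w2 (h : Admissible τ) : ContDiff ℝ ∞ (w2 τ) := by
  have h1 : ContDiff ℝ ∞ fun t => (rho τ t : ℂ) :=
    Complex.ofRealCLM.contDiff.comp (h.contDiff_y.sqrt fun t => (h.y_pos t).ne')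
  have h2 : ContDiff ℝ ∞ fun t => (psi2 τ t : ℂ) := Complex.ofRealCLM.contDiff.comp h.contDiff_psi2
  rw [funext h.w2_eq]
  exact h1.mul (contDiff_const.mul h2).cexp

theorem norm_w1_sq (h : Admissible τ) (t : ℝ) : ‖w1 τ t‖ ^ 2 = 1 - y τ t := by
  have := (sub_pos.2 (h.y_lt_one t)).le
  rw [h.w1_eq, norm_mul, mul_comm Complex.I, Complex.norm_exp_ofReal_mul_I]
  simp [Real.sq_sqrt this]

theorem norm_w2_sq (h : Admissible τ) (t : ℝ) : ‖w2 τ t‖ ^ 2 = y τ t := by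
  rw [h.w2_eq, norm_mul, mul_comm Complex.I, Complex.norm_exp_ofReal_mul_I]
  simp [h.rho_sq]

theorem w2_ne_zero (h : Admissible τ) (t : ℝ) : w2 τ t ≠ 0 := by
  rw [h.w2_eq]
  exact mul_ne_zero (by exact_mod_cast (h.rho_pos t).ne') (Complex.exp_ne_zero _)

theorem w1_ne_zero (h : Admissible τ) (t : ℝ) : w1 τ t ≠ 0 := by
  rw [← norm_ne_zero_iff, ← sq_pos_iff, h.norm_w1_sq]
  exact sub_pos.2 (h.y_lt_one t)

theorem w1_mul_w2_sq (h : Admissible τ) (t : ℝ) :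
    w1 τ t * w2 τ t ^ 2 = -Complex.I * (√(1 - y τ t) * y τ t : ℝ) *
      Complex.exp ((-Real.arctan (deriv (y τ) t / (4 * τ)) : ℝ) * Complex.I) := by
  rw [h.w1_eq, h.w2_eq, ← h.psi1_add_two_mul_psi2, mul_pow, ← Complex.exp_nat_mul,
    show ((psi1 τ t + 2 * psi2 τ t : ℝ) : ℂ) * Complex.I =
      Complex.I * psi1 τ t + (2 : ℕ) * (Complex.I * psi2 τ t) by push_cast; ring,
    Complex.exp_add, ← h.rho_sq]
  push_cast
  ring

theorem w1_add (h : Admissible τ) (t : ℝ) (j : ℤ) :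
    w1 τ (t + j * (2 * p τ)) = Complex.exp ((2 * j * pHat τ : ℝ) * Complex.I) * w1 τ t := by
  rw [h.w1_eq, h.w1_eq, h.periodic_y.int_mul j t, h.psi1_add, Complex.ofReal_add, mul_add,
    Complex.exp_add, mul_comm Complex.I ((2 * j * pHat τ : ℝ) : ℂ)]
  ring

theorem w2_add (h : Admissible τ) (t : ℝ) (j : ℤ) :
    w2 τ (t + j * (2 * p τ)) = Complex.exp ((-(j * pHat τ) : ℝ) * Complex.I) * w2 τ t := by
  rw [h.w2_eq, h.w2_eq, rho, h.periodic_y.int_mul j t, ← rho, h.psi2_add, sub_eq_add_neg,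
    Complex.ofReal_add, mul_add, Complex.exp_add, mul_comm Complex.I ((-(j * pHat τ) : ℝ) : ℂ)]
  ring

/-- Only w₂² is compared: on the cylinder a sign of w₂ could be absorbed by z ↦ -z. -/
theorem exists_eq_add_of_w_eq (h : Admissible τ) {t t' : ℝ} (h1 : w1 τ t = w1 τ t')
    (h2 : w2 τ t ^ 2 = w2 τ t' ^ 2) : ∃ j : ℤ, t' = t + j * (2 * p τ) := by
  have hy : y τ t = y τ t' := by
    linarith [h.norm_w1_sq t, h.norm_w1_sq t', congrArg (fun z => ‖z‖ ^ 2) h1]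
  refine h.exists_eq_add_of_y_eq hy ?_
  have h3 := congrArg₂ (· * ·) h1 h2
  simp only [h.w1_mul_w2_sq, hy] at h3
  have hne : -Complex.I * (√(1 - y τ t') * y τ t' : ℝ) ≠ 0 := by
    refine mul_ne_zero (neg_ne_zero.2 Complex.I_ne_zero) (Complex.ofReal_ne_zero.2 ?_)
    exact (mul_pos (Real.sqrt_pos.2 (sub_pos.2 (h.y_lt_one t'))) (h.y_pos t')).ne'
  have h4 := mul_left_cancel₀ hne h3
  have hcos := congrArg Complex.re h4
  have hsin := congrArg Complex.im h4
  rw [Complex.exp_ofReal_mul_I_re, Complex.exp_ofReal_mul_I_re, Real.cos_neg, Real.cos_neg] at hcos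
  rw [Complex.exp_ofReal_mul_I_im, Complex.exp_ofReal_mul_I_im, Real.sin_neg, Real.sin_neg,
    neg_inj] at hsin
  -- The tangent of the phase of w₁w₂² is -y'/(4τ), so equal phases give equal y'.
  have htan := Real.tan_eq_sin_div_cos (Real.arctan (deriv (y τ) t / (4 * τ)))
  rw [hsin, hcos, ← Real.tan_eq_sin_div_cos, Real.tan_arctan, Real.tan_arctan] at htan
  exact (div_left_inj' (mul_ne_zero four_ne_zero h.pos.ne')).1 htan

/-- Here w₂' = (ρ' + iρψ₂')e^{iψ₂}, and the imaginary part ρψ₂' = -2τ/ρ of the first factor is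
nonzero. -/
theorem exists_hasDerivAt_w2 (h : Admissible τ) (t : ℝ) :
    ∃ w' : ℂ, w' ≠ 0 ∧ HasDerivAt (w2 τ) w' t := by
  obtain ⟨ρ', hρ⟩ : ∃ ρ', HasDerivAt (rho τ) ρ' t :=
    ⟨_, (h.isConformalFactor_y.1 t).hasDerivAt.sqrt (h.y_pos t).ne'⟩
  have hw := hρ.ofReal_comp.mul (((h.hasDerivAt_psi2 t).ofReal_comp.const_mul Complex.I).cexp)
  rw [funext h.w2_eq]
  refine ⟨_, ?_, hw⟩
  set E := Complex.exp (Complex.I * (psi2 τ t : ℂ)) with hE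
  have hne : (ρ' : ℂ) + (rho τ t * (-2 * τ / y τ t) : ℝ) * Complex.I ≠ 0 := fun h0 => by
    have := congrArg Complex.im h0
    rw [Complex.add_im, Complex.ofReal_im, Complex.im_ofReal_mul, Complex.I_im, Complex.zero_im,
      zero_add, mul_one] at this
    exact mul_ne_zero (h.rho_pos t).ne'
      (div_ne_zero (mul_ne_zero (by norm_num) h.pos.ne') (h.y_pos t).ne') this
  convert mul_ne_zero hne (Complex.exp_ne_zero (Complex.I * (psi2 τ t : ℂ))) using 1
  rw [← hE]
  push_cast
  ring

/-! ### The immersion -/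

theorem X_mem_sphere (h : Admissible τ) (q : Circle × ℝ) : X τ q ∈ Metric.sphere (0 : C3) 1 := by
  have hz : ((q.1 : ℂ).re) ^ 2 + ((q.1 : ℂ).im) ^ 2 = 1 := by
    have := q.1.normSq_coe
    rw [Complex.normSq_apply] at this
    linarith
  rw [mem_sphere_zero_iff_norm, ← sq_eq_sq₀ (norm_nonneg _) zero_le_one,
    EuclideanSpace.norm_sq_eq, Fin.sum_univ_three]
  simp only [X, Matrix.cons_val_zero, Matrix.cons_val_one, Matrix.cons_val, norm_neg, norm_mul,
    mul_pow, Complex.norm_real, Real.norm_eq_abs, sq_abs, h.norm_w1_sq, h.norm_w2_sq]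
  linear_combination y τ q.2 * hz

theorem contDiff_X (h : Admissible τ) :
    ContDiff ℝ ∞ fun v : ℝ × ℝ => X τ (Circle.exp v.1, v.2) := by
  have h1 : ContDiff ℝ ∞ fun v : ℝ × ℝ => w1 τ v.2 := h.contDiff_w1.comp contDiff_snd
  have h2 : ContDiff ℝ ∞ fun v : ℝ × ℝ => w2 τ v.2 := h.contDiff_w2.comp contDiff_snd
  have hc : ContDiff ℝ ∞ fun v : ℝ × ℝ => (Real.cos v.1 : ℂ) :=
    Complex.ofRealCLM.contDiff.comp (Real.contDiff_cos.comp contDiff_fst)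
  have hs : ContDiff ℝ ∞ fun v : ℝ × ℝ => (Real.sin v.1 : ℂ) :=
    Complex.ofRealCLM.contDiff.comp (Real.contDiff_sin.comp contDiff_fst)
  rw [contDiff_piLp]
  intro i
  fin_cases i
  · simpa [X] using h1
  · exact (funext fun v : ℝ × ℝ => X_exp_apply_one τ v.1 v.2) ▸ h2.mul hc
  · exact (funext fun v : ℝ × ℝ => X_exp_apply_two τ v.1 v.2) ▸ (h2.mul hs).neg

theorem continuous_X (h : Admissible τ) : Continuous (X τ) := by
  have h1 := h.contDiff_w1.continuous
  have h2 := h.contDiff_w2.continuous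
  refine (PiLp.continuous_toLp 2 _).comp (continuous_pi fun i => ?_)
  fin_cases i <;> simp <;> fun_prop

/-- The last two coordinates suffice: differentiating w₂ cos s and w₂ sin s in a direction (a,b) of
the kernel isolates b w₂' and a w₂. -/
theorem injective_fderiv_X (h : Admissible τ) (v : ℝ × ℝ) : Function.Injective
    (fderiv ℝ (fun v : ℝ × ℝ => X τ (Circle.exp v.1, v.2)) v) := by
  rw [injective_iff_map_eq_zero]
  rintro ⟨a, b⟩ hab
  have hG := (h.contDiff_X.differentiable (by simp) v).hasFDerivAt
  have hcoord : ∀ i : Fin 3, HasFDerivAt (fun v : ℝ × ℝ => X τ (Circle.exp v.1, v.2) i)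
      ((PiLp.proj 2 (𝕜 := ℝ) (fun _ : Fin 3 => ℂ) i).comp
        (fderiv ℝ (fun v : ℝ × ℝ => X τ (Circle.exp v.1, v.2)) v)) v := fun i =>
    (PiLp.proj 2 (𝕜 := ℝ) (fun _ : Fin 3 => ℂ) i).hasFDerivAt.comp v hG
  have hline : HasDerivAt (fun x : ℝ => (v.1 + x * a, v.2 + x * b)) (a, b) 0 := by
    have h1 := ((hasDerivAt_id (0 : ℝ)).mul_const a).const_add v.1
    have h2 := ((hasDerivAt_id (0 : ℝ)).mul_const b).const_add v.2
    simpa using h1.prodMk h2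
  have hzero : ∀ i : Fin 3, HasDerivAt
      (fun x : ℝ => X τ (Circle.exp (v.1 + x * a), v.2 + x * b) i) 0 0 := fun i => by
    have h0 : v = (v.1 + (0 : ℝ) * a, v.2 + (0 : ℝ) * b) := by simp
    refine ((hcoord i).comp_hasDerivAt_of_eq (0 : ℝ) hline h0).congr_deriv ?_
    simp [hab]
  obtain ⟨w', hw', hw⟩ := h.exists_hasDerivAt_w2 v.2
  have hs : HasDerivAt (fun x : ℝ => v.1 + x * a) a 0 := by
    simpa using ((hasDerivAt_id (0 : ℝ)).mul_const a).const_add v.1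
  have ht : HasDerivAt (fun x : ℝ => v.2 + x * b) b 0 := by
    simpa using ((hasDerivAt_id (0 : ℝ)).mul_const b).const_add v.2
  have hwt : HasDerivAt (fun x : ℝ => w2 τ (v.2 + x * b)) (b • w') 0 := by
    have h0 : HasDerivAt (w2 τ) w' (v.2 + 0 * b) := by simpa using hw
    exact h0.scomp (0 : ℝ) ht
  have hcos := hs.cos.ofReal_comp
  have hsin := hs.sin.ofReal_comp
  have e1 : HasDerivAt (fun x : ℝ => w2 τ (v.2 + x * b) * (Real.cos (v.1 + x * a) : ℂ)) 0 0 := by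
    simpa only [X_exp_apply_one] using hzero 1
  have e2 : HasDerivAt (fun x : ℝ => w2 τ (v.2 + x * b) * (Real.sin (v.1 + x * a) : ℂ)) 0 0 := by
    simpa only [X_exp_apply_two, Pi.neg_def, neg_neg, neg_zero] using (hzero 2).neg
  have f1 := e1.unique (hwt.mul hcos)
  have f2 := e2.unique (hwt.mul hsin)
  simp only [zero_mul, add_zero, Complex.real_smul, Complex.ofReal_mul, Complex.ofReal_neg] at f1 f2
  have hsc : (Real.sin v.1 : ℂ) ^ 2 + (Real.cos v.1 : ℂ) ^ 2 = 1 := by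
    exact_mod_cast Real.sin_sq_add_cos_sq v.1
  -- Rotating the two equations by the angle s decouples them.
  have hb : (b : ℂ) * w' = 0 := by
    linear_combination (-b * w') * hsc - Real.cos v.1 * f1 - Real.sin v.1 * f2
  have ha : w2 τ v.2 * (a : ℂ) = 0 := by
    linear_combination (-w2 τ v.2 * a) * hsc + Real.sin v.1 * f1 - Real.cos v.1 * f2
  have hb' : b = 0 := by simpa [hw'] using hb
  have ha' : a = 0 := by simpa [h.w2_ne_zero] using ha
  rw [ha', hb']
  rfl

end Admissible

/-! ### Closing condition -/

/-- The closing condition of the embedded tori, in the form `p̂_τ = 2πn/m` with `m` odd and coprime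
to `n`. -/
structure ClosingCondition (n m : ℕ) (τ : ℝ) : Prop extends Admissible τ where
  pos_m : 0 < m
  coprime : IsCoprime (m : ℤ) (2 * n)
  mul_pHat : m * pHat τ = n * (2 * π)

namespace ClosingCondition

variable {n m : ℕ} {τ : ℝ}

theorem period_pos (h : ClosingCondition n m τ) : 0 < 2 * (m : ℝ) * p τ := by
  have := h.p_pos
  have := h.pos_m
  positivity

theorem X_eq_X_iff (h : ClosingCondition n m τ) (q q' : Circle × ℝ) :
    X τ q = X τ q' ↔ q.1 = q'.1 ∧ ∃ l : ℤ, q'.2 = q.2 + l * (2 * m * p τ) := by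
  have hm : (m : ℝ) ≠ 0 := by exact_mod_cast h.pos_m.ne'
  have hper : ∀ (t : ℝ) (l : ℤ), w1 τ (t + l * (2 * m * p τ)) = w1 τ t ∧
      w2 τ (t + l * (2 * m * p τ)) = w2 τ t := fun t l => by
    have e : (l : ℝ) * (2 * m * p τ) = ((l * m : ℤ) : ℝ) * (2 * p τ) := by push_cast; ring
    have hl : ((l * m : ℤ) : ℝ) * pHat τ = ((l * n : ℤ) : ℝ) * (2 * π) := by
      push_cast
      linear_combination (l : ℝ) * h.mul_pHat
    rw [e, h.w1_add, h.w2_add, mul_assoc, hl]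
    constructor
    · rw [Complex.exp_eq_one_iff.2 ⟨2 * (l * n), by push_cast; ring⟩, one_mul]
    · rw [Complex.exp_eq_one_iff.2 ⟨-(l * n), by push_cast; ring⟩, one_mul]
  constructor
  · intro hq
    have e0 : w1 τ q.2 = w1 τ q'.2 := by simpa [X] using congrArg (fun x : C3 => x 0) hq
    have e1 : w2 τ q.2 * ((q.1 : ℂ).re : ℂ) = w2 τ q'.2 * ((q'.1 : ℂ).re : ℂ) := by
      simpa [X] using congrArg (fun x : C3 => x 1) hq
    have e2 : w2 τ q.2 * ((q.1 : ℂ).im : ℂ) = w2 τ q'.2 * ((q'.1 : ℂ).im : ℂ) := by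
      simpa [X] using congrArg (fun x : C3 => x 2) hq
    have hz : ∀ z : Circle, ((z : ℂ).re : ℂ) ^ 2 + ((z : ℂ).im : ℂ) ^ 2 = 1 := fun z => by
      have := z.normSq_coe
      rw [Complex.normSq_apply] at this
      norm_cast
      linarith
    have hsq : w2 τ q.2 ^ 2 = w2 τ q'.2 ^ 2 := by
      linear_combination (w2 τ q.2 * ((q.1 : ℂ).re : ℂ) + w2 τ q'.2 * ((q'.1 : ℂ).re : ℂ)) * e1 +
        (w2 τ q.2 * ((q.1 : ℂ).im : ℂ) + w2 τ q'.2 * ((q'.1 : ℂ).im : ℂ)) * e2 -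
        w2 τ q.2 ^ 2 * hz q.1 + w2 τ q'.2 ^ 2 * hz q'.1
    obtain ⟨j, hj⟩ := h.exists_eq_add_of_w_eq e0 hsq
    rw [hj, h.w1_add] at e0
    have hexp := (mul_eq_right₀ (h.w1_ne_zero _)).1 e0.symm
    obtain ⟨i, hi⟩ := Complex.exp_eq_one_iff.1 hexp
    have hi' : 2 * j * pHat τ = i * (2 * π) := by
      have hi2 : ((2 * j * pHat τ : ℝ) : ℂ) = ((i * (2 * π) : ℝ) : ℂ) := by
        apply mul_right_cancel₀ Complex.I_ne_zero
        rw [hi]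
        push_cast
        ring
      exact_mod_cast hi2
    have hdvd : (2 * n : ℤ) * j = m * i := by
      have : ((2 * n : ℤ) * j : ℝ) = m * i := by
        apply mul_right_cancel₀ (show 2 * π ≠ 0 by positivity)
        push_cast
        linear_combination (m : ℝ) * hi' - 2 * j * h.mul_pHat
      exact_mod_cast this
    -- The factor 2 in the coprimality is needed because w₁ turns by 2p̂ per period of y.
    obtain ⟨l, hl⟩ := h.coprime.dvd_of_dvd_mul_left ⟨i, hdvd⟩
    have hj' : q'.2 = q.2 + l * (2 * m * p τ) := by
      rw [hj, hl]
      push_cast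
      ring
    refine ⟨?_, l, hj'⟩
    rw [hj', (hper _ _).2] at e1 e2
    refine Circle.ext (Complex.ext ?_ ?_)
    · exact_mod_cast mul_left_cancel₀ (h.w2_ne_zero _) e1
    · exact_mod_cast mul_left_cancel₀ (h.w2_ne_zero _) e2
  · rintro ⟨hz, l, hl⟩
    simp only [X, hz, hl, (hper _ _).1, (hper _ _).2]

theorem Per_X (h : ClosingCondition n m τ) : Per (X τ) =
    (Submodule.span ℤ {((2 * π, 0) : ℝ × ℝ), (0, 2 * (m : ℝ) * p τ)} : Set (ℝ × ℝ)) := by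
  ext ⟨s, t⟩
  rw [SetLike.mem_coe, Submodule.mem_span_pair]
  constructor
  · intro hv
    -- One base point is enough, because `X_eq_X_iff` is an equivalence at every pair of points.
    have h1 := congrFun (show X τ ∘ S s ∘ T t = X τ from hv) (1, 0)
    obtain ⟨hs, l, hl⟩ := (h.X_eq_X_iff _ _).1 h1
    simp only [Function.comp, S, T, one_mul, zero_add] at hs hl
    obtain ⟨i, hi⟩ := Circle.exp_eq_one.1 hs
    refine ⟨i, -l, Prod.ext ?_ ?_⟩
    · simp [hi]
    · simp
      linarith
  · rintro ⟨i, l, hil⟩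
    rw [Prod.ext_iff, Prod.fst_add, Prod.snd_add, Prod.smul_fst, Prod.smul_fst, Prod.smul_snd,
      Prod.smul_snd, smul_zero, smul_zero, add_zero, zero_add, zsmul_eq_mul, zsmul_eq_mul] at hil
    have hs : i * (2 * π) = s := hil.1
    have ht : l * (2 * m * p τ) = t := hil.2
    refine funext fun q => (h.X_eq_X_iff _ _).2 ⟨?_, -l, ?_⟩
    · simp only [Function.comp, S, T]
      rw [← hs, Circle.exp_eq_one.2 ⟨i, rfl⟩, mul_one]
    · simp only [Function.comp, S, T, ← ht]
      push_cast
      ring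

/-! ### The embedded torus -/

theorem periodic_X (h : ClosingCondition n m τ) (z : Circle) :
    Function.Periodic (fun t => X τ (z, t)) (2 * (m : ℝ) * p τ) := fun t =>
  (h.X_eq_X_iff _ _).2 ⟨rfl, -1, by push_cast; ring⟩

/-- The map induced by `X_τ` on the torus `S¹ × (ℝ / 2mp_τ ℤ)`. -/
def torusMap (h : ClosingCondition n m τ) (q : Circle × AddCircle (2 * (m : ℝ) * p τ)) : C3 :=
  (h.periodic_X q.1).lift q.2

theorem torusMap_coe (h : ClosingCondition n m τ) (z : Circle) (t : ℝ) :
    h.torusMap (z, (t : AddCircle (2 * (m : ℝ) * p τ))) = X τ (z, t) := rfl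

theorem continuous_torusMap (h : ClosingCondition n m τ) : Continuous h.torusMap := by
  have hq : IsOpenQuotientMap (Prod.map (id : Circle → Circle)
      (QuotientAddGroup.mk : ℝ → AddCircle (2 * (m : ℝ) * p τ))) :=
    IsOpenQuotientMap.id.prodMap QuotientAddGroup.isOpenQuotientMap_mk
  exact hq.isQuotientMap.continuous_iff.2 h.continuous_X

theorem injective_torusMap (h : ClosingCondition n m τ) : Function.Injective h.torusMap := by
  rintro ⟨z, t⟩ ⟨z', t'⟩ hq
  induction t using QuotientAddGroup.induction_on with | H t => ?_
  induction t' using QuotientAddGroup.induction_on with | H t' => ?_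
  obtain ⟨hz, l, hl⟩ := (h.X_eq_X_iff (z, t) (z', t')).1 hq
  simp only at hz hl
  refine Prod.ext hz ?_
  simp only [hl]
  symm
  rw [QuotientAddGroup.mk_add, add_eq_left]
  exact (AddCircle.coe_eq_zero_iff _).2 ⟨l, by simp⟩

theorem isEmbeddedTorus_torusMap (h : ClosingCondition n m τ) :
    IsEmbeddedTorus (2 * (m : ℝ) * p τ) h.torusMap where
  mem_sphere := by
    rintro ⟨z, t⟩
    induction t using QuotientAddGroup.induction_on with | H t => ?_
    exact h.X_mem_sphere (z, t)
  contDiff := h.contDiff_X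
  injective_fderiv := h.injective_fderiv_X
  isEmbedding := by
    have : Fact (0 < 2 * (m : ℝ) * p τ) := ⟨h.period_pos⟩
    -- A continuous injection from a compact space to a Hausdorff space is a closed embedding.
    exact (h.continuous_torusMap.isClosedEmbedding h.injective_torusMap).isEmbedding

end ClosingCondition

/-! ### The isometries -/

theorem tildeT_eq_tildeT_neg (n : ℕ) : tildeT (n * (2 * π)) = tildeT (-(n * (2 * π))) := by
  have h1 : Complex.exp (Complex.I * (n * (2 * π) : ℝ)) =
      Complex.exp (Complex.I * (-(n * (2 * π)) : ℝ)) :=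
    Complex.exp_eq_exp_iff_exists_int.2 ⟨2 * n, by push_cast; ring⟩
  have h2 : Complex.exp (-(Complex.I * (n * (2 * π) : ℝ)) / 2) =
      Complex.exp (-(Complex.I * (-(n * (2 * π)) : ℝ)) / 2) :=
    Complex.exp_eq_exp_iff_exists_int.2 ⟨-n, by push_cast; ring⟩
  rw [tildeT, tildeT, h1, h2]

/-- At x = 2πn the diagonal map fixes ie₁ and multiplies e₂ and e₃ by the real sign (-1)ⁿ, so it
preserves their real span. -/
theorem reflSpace_eq_reflBase (n : ℕ) : reflSpace (n * (2 * π)) = reflBase := by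
  have h1 : Complex.exp (Complex.I * (n * (2 * π) : ℝ)) = 1 :=
    Complex.exp_eq_one_iff.2 ⟨n, by push_cast; ring⟩
  have h2 : Complex.exp (-(Complex.I * (n * (2 * π) : ℝ)) / 2) = ((-1 : ℝ) ^ n : ℝ) := by
    rw [show -(Complex.I * (n * (2 * π) : ℝ)) / 2 = n * -(π * Complex.I) by push_cast; ring,
      Complex.exp_nat_mul, Complex.exp_neg, Complex.exp_pi_mul_I]
    norm_num
  have hε : ((-1 : ℝ) ^ n) * ((-1 : ℝ) ^ n) = 1 := by rw [← mul_pow]; norm_num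
  set ε : ℝ := (-1 : ℝ) ^ n
  have hT : tildeT (n * (2 * π)) = Matrix.diagonal ![1, (ε : ℂ), (ε : ℂ)] := by
    rw [tildeT, h1, h2]
  set D : C3 →ₗ[ℝ] C3 := (Matrix.toEuclideanLin (tildeT (n * (2 * π)))).restrictScalars ℝ with hD
  have hDx : ∀ x : C3, D x = !₂[x 0, ε * x 1, ε * x 2] := fun x => by
    rw [hD, hT]
    ext i
    fin_cases i <;> simp [Matrix.toLpLin_apply, Matrix.mulVec_diagonal]
  have hle : reflBase.map D ≤ reflBase := by
    rw [reflBase, Submodule.map_span_le]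
    rintro x (rfl | rfl | rfl)
    · have : D (Complex.I • EuclideanSpace.single 0 1) = Complex.I • EuclideanSpace.single 0 1 := by
        rw [hDx]
        ext i
        fin_cases i <;> simp
      rw [this]
      exact Submodule.subset_span (by simp)
    · have : D (EuclideanSpace.single 1 1) = ε • EuclideanSpace.single 1 1 := by
        rw [hDx]
        ext i
        fin_cases i <;> simp
      rw [this]
      exact Submodule.smul_mem _ _ (Submodule.subset_span (by simp))
    · have : D (EuclideanSpace.single 2 1) = ε • EuclideanSpace.single 2 1 := by
        rw [hDx]
        ext i
        fin_cases i <;> simp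
      rw [this]
      exact Submodule.smul_mem _ _ (Submodule.subset_span (by simp))
  -- The map D is an involution, so D x is a preimage of x.
  refine le_antisymm hle fun x hx => ⟨D x, hle ⟨x, hx, rfl⟩, ?_⟩
  have hε' : (ε : ℂ) * ε = 1 := by exact_mod_cast hε
  rw [hDx, hDx]
  ext i
  fin_cases i <;> simp [← mul_assoc, hε']

end U1Torus

end

theorem lemmaL (n m : ℕ) (hm : (m : ℤ) = 4 * (n : ℤ) - 1) (τ : ℝ) (hτ₀ : 0 < τ)
    (hτ₁ : τ < 1 / (3 * √3)) (hτ : U1Torus.pHat τ = π / 2 * (1 + 1 / (m : ℝ))) :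
    U1Torus.Per (U1Torus.X τ) =
        (Submodule.span ℤ {((2 * π, 0) : ℝ × ℝ), (0, 2 * (m : ℝ) * U1Torus.p τ)} : Set (ℝ × ℝ)) ∧
      U1Torus.tildeT ((m : ℝ) * U1Torus.pHat τ) = U1Torus.tildeT (-((m : ℝ) * U1Torus.pHat τ)) ∧
      U1Torus.reflT ((m : ℝ) * U1Torus.pHat τ) = U1Torus.reflT (-((m : ℝ) * U1Torus.pHat τ)) ∧
      U1Torus.reflT (-((m : ℝ) * U1Torus.pHat τ)) = U1Torus.reflT0 ∧
      ∃ F : Circle × AddCircle (2 * (m : ℝ) * U1Torus.p τ) → U1Torus.C3,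
        U1Torus.IsEmbeddedTorus (2 * (m : ℝ) * U1Torus.p τ) F ∧
          ∀ (z : Circle) (t : ℝ), U1Torus.X τ (z, t) = F (z, (t : AddCircle _)) := by
  -- The equation `m = 4n - 1` over ℤ with m natural already excludes n = 0.
  have hm0 : 0 < m := by omega
  have hmR : (m : ℝ) = 4 * n - 1 := by exact_mod_cast hm
  have hmul : m * U1Torus.pHat τ = n * (2 * π) := by
    have : (m : ℝ) ≠ 0 := by exact_mod_cast hm0.ne'
    rw [hτ]
    field_simp
    rw [hmR]
    ring
  have h : U1Torus.ClosingCondition n m τ :=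
    -- The Bézout relation is (-1)·m + 2·(2n) = 1.
    { pos := hτ₀, lt := hτ₁, pos_m := hm0, coprime := ⟨-1, 2, by omega⟩, mul_pHat := hmul }
  have hT := U1Torus.tildeT_eq_tildeT_neg n
  have hR := U1Torus.reflSpace_eq_reflBase n
  have hR' : U1Torus.reflSpace (-(n * (2 * π))) = U1Torus.reflBase := by
    rw [U1Torus.reflSpace, ← hT, ← U1Torus.reflSpace, hR]
  rw [hmul]
  refine ⟨h.Per_X, hT, ?_, ?_, h.torusMap, h.isEmbeddedTorus_torusMap,
    fun z t => (h.torusMap_coe z t).symm⟩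
  · simp only [U1Torus.reflT, hR, hR']
  · simp only [U1Torus.reflT, U1Torus.reflT0, hR']
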